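/- Theorem. For an irrational real number $x$ let $$k(x)=\sup\Big\{c>0 \;\Big|\; \Big|x-\frac pq\Big|<\frac1{cq^2}\text{ has infinitely many rational solutions }\frac pq\Big\}\in(0,\infty]$$ be its Lagrange value, where a rational solution is a rational number $p/q$ written in lowest terms with $q\ge 1$. For a bi-infinite sequence $\omega=(\omega_i)_{i\in\mathbb Z}$ of positive integers let $$m(\omega)=\sup_{n\in\mathbb Z}\big([\omega_n;\omega_{n+1},\omega_{n+2},\dots]+[0;\omega_{n-1},\omega_{n-2},\dots]\big)\in(0,\infty]$$ be its Markov value, where $[a_0;a_1,a_2,\dots]$ denotes the value of the continued fraction, and let $\pi(\omega)=(\omega_i)_{i\ge 0}$. For $n\in\mathbb N\cup\{\infty\}$, with $\mathbb N=\{0,1,2,\dots\}$, let $$X_3(n)=\Big\{x\in\mathbb R\setminus\mathbb Q \;\Big|\; k(x)=3 \text{ and } \Big|x-\frac pq\Big|<\frac1{3q^2}\text{ has exactly } n \text{ rational solutions }\frac pq\Big\},$$ $$Y_3(n)=\big\{x\in X_3(n) \;\big|\; x=[0;\pi(\omega)]=[0;\omega_0,\omega_1,\omega_2,\dots]\text{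 for some bi-infinite sequence }\omega\text{ with } m(\omega)=3\big\}.$$ Then for every $n\in\mathbb N\cup\{\infty\}$ the set $Y_3(n)$ is uncountable. -/

import Mathlib

namespace LagrangeThree

open Filter Topology

noncomputable section

/-- The formal infinite continued fraction `[a₀; a 0, a 1, a 2, …]`. -/
def contFrac (a₀ : ℤ) (a : ℕ → ℕ+) : GenContFract ℝ :=
  ⟨(a₀ : ℝ), Stream'.Seq.ofStream (fun i => ⟨1, ((a i : ℕ) : ℝ)⟩)⟩

/-- The real number `[a₀; a 0, a 1, a 2, …]`, the limit of the convergents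
(the limit exists, see `tendsto_convs`). -/
def cfValue (a₀ : ℤ) (a : ℕ → ℕ+) : ℝ :=
  limUnder atTop (contFrac a₀ a).convs

theorem contFrac_get (a₀ : ℤ) (a : ℕ → ℕ+) (n : ℕ) :
    (contFrac a₀ a).s.get? n = some ⟨1, ((a n : ℕ) : ℝ)⟩ := rfl

theorem dens_zero (a₀ : ℤ) (a : ℕ → ℕ+) : (contFrac a₀ a).dens 0 = 1 :=
  GenContFract.zeroth_den_eq_one

theorem dens_one (a₀ : ℤ) (a : ℕ → ℕ+) : (contFrac a₀ a).dens 1 = (a 0 : ℕ) :=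
  GenContFract.first_den_eq (contFrac_get a₀ a 0)

theorem nums_zero (a₀ : ℤ) (a : ℕ → ℕ+) : (contFrac a₀ a).nums 0 = a₀ :=
  GenContFract.zeroth_num_eq_h

theorem nums_one (a₀ : ℤ) (a : ℕ → ℕ+) :
    (contFrac a₀ a).nums 1 = (a 0 : ℕ) * a₀ + 1 :=
  GenContFract.first_num_eq (contFrac_get a₀ a 0)

theorem dens_rec (a₀ : ℤ) (a : ℕ → ℕ+) (n : ℕ) :
    (contFrac a₀ a).dens (n + 2) =
      (a (n + 1) : ℕ) * (contFrac a₀ a).dens (n + 1) + (contFrac a₀ a).dens n := by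
  rw [GenContFract.dens_recurrence (contFrac_get a₀ a (n + 1)) rfl rfl, one_mul]

theorem nums_rec (a₀ : ℤ) (a : ℕ → ℕ+) (n : ℕ) :
    (contFrac a₀ a).nums (n + 2) =
      (a (n + 1) : ℕ) * (contFrac a₀ a).nums (n + 1) + (contFrac a₀ a).nums n := by
  rw [GenContFract.nums_recurrence (contFrac_get a₀ a (n + 1)) rfl rfl, one_mul]

theorem one_le_letter (a : ℕ → ℕ+) (n : ℕ) : (1 : ℝ) ≤ ((a n : ℕ) : ℝ) := by
  exact_mod_cast (a n).pos

theorem dens_mono (a₀ : ℤ) (a : ℕ → ℕ+) (n : ℕ) :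
    1 ≤ (contFrac a₀ a).dens n ∧ (contFrac a₀ a).dens n ≤ (contFrac a₀ a).dens (n + 1) := by
  induction n with
  | zero =>
    rw [dens_zero, zero_add, dens_one]
    exact ⟨le_refl _, one_le_letter a 0⟩
  | succ n ih =>
    refine ⟨ih.1.trans ih.2, ?_⟩
    rw [dens_rec]
    nlinarith [one_le_letter a (n + 1), ih.1, ih.2]

theorem two_pow_le (a₀ : ℤ) (a : ℕ → ℕ+) (n : ℕ) :
    (2 : ℝ) ^ n ≤ (contFrac a₀ a).dens n * (contFrac a₀ a).dens (n + 1) := by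
  induction n with
  | zero =>
    have h := dens_mono a₀ a 0
    rw [pow_zero]
    nlinarith [h.1, h.2]
  | succ n ih =>
    have h := dens_mono a₀ a n
    have h2 : 2 * (contFrac a₀ a).dens n ≤ (contFrac a₀ a).dens (n + 2) := by
      rw [dens_rec]
      nlinarith [one_le_letter a (n + 1), h.1, h.2]
    rw [pow_succ]
    nlinarith [h.1, h.2]

theorem nums_dens_det (a₀ : ℤ) (a : ℕ → ℕ+) (n : ℕ) :
    (contFrac a₀ a).nums n * (contFrac a₀ a).dens (n + 1)
      - (contFrac a₀ a).dens n * (contFrac a₀ a).nums (n + 1) = (-1) ^ (n + 1) := by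
  induction n with
  | zero =>
    rw [zero_add, nums_zero, nums_one, dens_zero, dens_one]
    ring
  | succ n ih =>
    rw [nums_rec, dens_rec, pow_succ, ← ih]
    ring

theorem tendsto_convs (a₀ : ℤ) (a : ℕ → ℕ+) :
    Tendsto (contFrac a₀ a).convs atTop (𝓝 (cfValue a₀ a)) := by
  refine CauchySeq.tendsto_limUnder ?_
  refine cauchySeq_of_le_geometric (1 / 2) 1 (by norm_num) (fun n => ?_)
  have h := dens_mono a₀ a n
  have h0 : 0 < (contFrac a₀ a).dens n := by linarith [h.1]
  have h1 : 0 < (contFrac a₀ a).dens (n + 1) := by linarith [h.1, h.2]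
  change dist ((contFrac a₀ a).nums n / (contFrac a₀ a).dens n)
    ((contFrac a₀ a).nums (n + 1) / (contFrac a₀ a).dens (n + 1)) ≤ _
  rw [Real.dist_eq, div_sub_div _ _ h0.ne' h1.ne', nums_dens_det, abs_div, abs_pow, abs_neg,
    abs_one, one_pow, abs_of_pos (mul_pos h0 h1), one_mul, one_div_pow]
  exact one_div_le_one_div_of_le (by positivity) (two_pow_le a₀ a n)

/-- Rational solutions `p/q` (in lowest terms) of `|x - p/q| < 1/(c q²)`. -/
def solutions (c x : ℝ) : Set ℚ :=
  {r : ℚ | |x - (r : ℝ)| < 1 / (c * (r.den : ℝ) ^ 2)}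

/-- The Lagrange value `k(x)`, as an extended real number. -/
def lagrangeValue (x : ℝ) : EReal :=
  ⨆ c ∈ {c : ℝ | 0 < c ∧ (solutions c x).Infinite}, (c : EReal)

/-- Bi-infinite words over the alphabet of positive integers. -/
abbrev BiWord : Type := ℤ → ℕ+

/-- The word `w` re-centred at position `n`. -/
def shift (n : ℤ) (w : BiWord) : BiWord := fun i => w (n + i)

/-- The height `[w₀; w₁, w₂, …] + [0; w₋₁, w₋₂, …]`. -/
def height (w : BiWord) : ℝ :=
  cfValue (((w 0 : ℕ+) : ℕ) : ℤ) (fun i : ℕ => w ((i : ℤ) + 1)) +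
    cfValue 0 (fun i : ℕ => w (-((i : ℤ) + 1)))

/-- The Markov value `m(w)`, as an extended real number. -/
def markovValue (w : BiWord) : EReal :=
  ⨆ n : ℤ, ((height (shift n w) : ℝ) : EReal)

/-- The projection to the right part `w₀ w₁ w₂ …`. -/
def proj (w : BiWord) : ℕ → ℕ+ := fun i => w (i : ℤ)

/-- Irrational numbers with Lagrange value `3` for which `|x - p/q| < 1/(3q²)` has exactly `n`
rational solutions. -/
def X3 (n : ℕ∞) : Set ℝ :=
  {x : ℝ | Irrational x ∧ lagrangeValue x = 3 ∧ (solutions 3 x).encard = n}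

/-- The elements of `X3 n` of the form `[0; w₀, w₁, w₂, …]` with `w` a bi-infinite word of
Markov value `3`. -/
def Y3 (n : ℕ∞) : Set ℝ :=
  {x : ℝ | x ∈ X3 n ∧ ∃ w : BiWord, markovValue w = 3 ∧ x = cfValue 0 (proj w)}

end

end LagrangeThree

/-
Code a bi-infinite binary word by the digits `2` (for `true`) and `1` (for `false`), each repeated
twice. If the word is balanced, then every height is at most `3`, heights close to `3` occur exactly
at factors `true, false` about which the word is symmetric to a large depth, and a convergent of the
right half has quality above `3` exactly when such a symmetry extends to the start of that half.

For the mechanical word of irrational slope `α` and intercept `N α`, this happens precisely at the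
times `q` at which the orbit `(q + N) α` of the rotation by `α` is closer to `0` from above than all
of `± α, …, ± q α`. For `N = 1` there are infinitely many such times and for `N = 0` there are none.
Replacing `N = -M` by `-(M + Q)`, where `-Q α` is extremely close to `0` from above, adds exactly
the time `q = M + Q`, at which the orbit hits `0`; so every finite number of such times occurs too.
Finally, the slope `α` is the density of `true` in the word, so uncountably many values arise.
-/

namespace LagrangeThree

noncomputable section

/-- The point `x` of the circle `ℝ/ℤ` lies closer to `0`, going counterclockwise, than every
multiple `j α` with `0 < |j| < m`. -/
def FractBelow (α : ℝ) (m : ℕ) (x : ℝ) : Prop :=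
  ∀ j : ℤ, j ≠ 0 → |j| < m → Int.fract x < Int.fract (j * α)

/-- The indices `q > 0` at which the orbit `(q + N) α` of the rotation by `α` lies closer to `0`
than every multiple `j α` with `0 < |j| ≤ q`. -/
def records (α : ℝ) (N : ℤ) : Set ℕ :=
  {q : ℕ | 0 < q ∧ FractBelow α (q + 1) ((q + N) * α)}

theorem FractBelow.mono {α x : ℝ} {m n : ℕ} (h : FractBelow α n x) (hmn : m ≤ n) :
    FractBelow α m x :=
  fun j hj hjm => h j hj (hjm.trans_le (by exact_mod_cast hmn))

theorem FractBelow.of_neg {α x : ℝ} {m : ℕ} (h : FractBelow (-α) m x) : FractBelow α m x :=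
  fun j hj hjm => by
    have := h (-j) (neg_ne_zero.2 hj) (by rwa [abs_neg])
    rwa [Int.cast_neg, neg_mul_neg] at this

theorem fract_intCast_mul_pos {α : ℝ} (hα : Irrational α) {j : ℤ} (hj : j ≠ 0) :
    0 < Int.fract (j * α) :=
  Int.fract_pos.2 ((hα.intCast_mul hj).ne_int _)

section Fract

variable {R : Type*} [Ring R] [LinearOrder R] [FloorRing R] [IsOrderedRing R] {x y : R}

theorem fract_sub_of_le (h : Int.fract y ≤ Int.fract x) :
    Int.fract (x - y) = Int.fract x - Int.fract y := by
  rw [Int.fract_eq_iff]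
  refine ⟨sub_nonneg.2 h, ?_, ⌊x⌋ - ⌊y⌋, ?_⟩
  · exact (sub_le_self _ (Int.fract_nonneg y)).trans_lt (Int.fract_lt_one x)
  · push_cast [Int.fract]
    abel

theorem fract_add_of_lt (h : Int.fract x + Int.fract y < 1) :
    Int.fract (x + y) = Int.fract x + Int.fract y := by
  rw [Int.fract_eq_iff]
  refine ⟨add_nonneg (Int.fract_nonneg x) (Int.fract_nonneg y), h, ⌊x⌋ + ⌊y⌋, ?_⟩
  push_cast [Int.fract]
  abel

end Fract

theorem fractBelow_zero {α : ℝ} (hα : Irrational α) (m : ℕ) : FractBelow α m 0 :=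
  fun j hj _ => by simpa only [Int.fract_zero] using fract_intCast_mul_pos hα hj

theorem exists_natCast_mul_fract_lt (α : ℝ) {ε : ℝ} (hε : 0 < ε) :
    ∃ q : ℕ, 0 < q ∧ (Int.fract (q * α) < ε ∨ Int.fract (-(q * α)) < ε) := by
  obtain ⟨n, hn⟩ := exists_nat_one_div_lt hε
  obtain ⟨q, hq, -, h⟩ := Real.exists_nat_abs_mul_sub_round_le α n.succ_pos
  refine ⟨q, hq, ?_⟩
  have hlt : |q * α - round (q * α)| < ε := by
    refine (h.trans ?_).trans_lt hn
    push_cast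
    gcongr
    linarith
  rw [abs_sub_round_eq_min, min_lt_iff] at hlt
  refine hlt.imp_right fun h' => ?_
  by_cases h0 : Int.fract (q * α) = 0
  · rwa [Int.fract_neg_eq_zero.2 h0]
  · rwa [Int.fract_neg h0]

theorem exists_least_fract_lt (α : ℝ) {ε : ℝ} (hε : 0 < ε) :
    ∃ q : ℕ, 0 < q ∧ (Int.fract (q * α) < ε ∨ Int.fract (-(q * α)) < ε) ∧
      ∀ j : ℤ, j ≠ 0 → |j| < q → ε ≤ Int.fract (j * α) := by
  classical
  have hex := exists_natCast_mul_fract_lt α hε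
  refine ⟨Nat.find hex, (Nat.find_spec hex).1, (Nat.find_spec hex).2, fun j hj hlt => ?_⟩
  obtain ⟨n, rfl | rfl⟩ := j.eq_nat_or_neg
  · have := Nat.find_min hex (m := n) (by simpa using hlt)
    simp only [not_and, not_or, not_lt] at this
    exact_mod_cast (this (by omega)).1
  · have := Nat.find_min hex (m := n) (by simpa using hlt)
    simp only [not_and, not_or, not_lt] at this
    simpa only [Int.cast_neg, Int.cast_natCast, neg_mul] using (this (by omega)).2

theorem exists_fract_lt_and_fractBelow {α : ℝ} (hα : Irrational α) {ε : ℝ} (hε : 0 < ε) :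
    ∃ q : ℕ, 0 < q ∧ Int.fract (q * α) < ε ∧ FractBelow α q (q * α) := by
  obtain ⟨r, hr, h | h, hmin⟩ := exists_least_fract_lt α hε
  · exact ⟨r, hr, h, fun j hj hjr => h.trans_le (hmin j hj hjr)⟩
  -- `r α` approaches `0` from the wrong side, so the next best approximation is on the right side.
  have hη : 0 < Int.fract (-(r * α)) := by
    have := fract_intCast_mul_pos hα (j := -r) (by omega)
    push_cast at this
    rwa [← neg_mul]
  obtain ⟨s, hs, hs', hmin'⟩ := exists_least_fract_lt α hη
  suffices hlt : Int.fract (s * α) < Int.fract (-(r * α)) from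
    ⟨s, hs, hlt.trans h, fun j hj hjs => hlt.trans_le (hmin' j hj hjs)⟩
  refine hs'.resolve_right fun hneg => ?_
  have hrs : r < s := by
    by_contra! hsr
    have hne : s ≠ r := by
      rintro rfl
      exact hneg.false
    have := hmin (-s) (by omega) (by rw [abs_neg, Nat.abs_cast]; omega)
    push_cast at this
    rw [neg_mul] at this
    linarith
  have hle := hmin' (s - r) (by omega) (by rw [abs_of_pos] <;> omega)
  have hsub := fract_sub_of_le hneg.le
  have hpos : 0 < Int.fract (-(s * α)) := by
    have := fract_intCast_mul_pos hα (j := -s) (by omega)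
    push_cast at this
    rwa [← neg_mul]
  push_cast at hle
  rw [show ((s : ℝ) - r) * α = -(r * α) - -(s * α) by ring, hsub] at hle
  linarith

theorem exists_pos_forall_le_fract {α : ℝ} (hα : Irrational α) (n : ℕ) :
    ∃ ε > 0, ∀ j : ℤ, j ≠ 0 → |j| ≤ n → ε ≤ Int.fract (j * α) := by
  obtain ⟨i, hi, hmin⟩ := ((Finset.Icc (-n : ℤ) (n + 1)).erase 0).exists_min_image
    (fun j => Int.fract (j * α)) ⟨n + 1, by rw [Finset.mem_erase, Finset.mem_Icc]; omega⟩
  refine ⟨_, fract_intCast_mul_pos hα (Finset.ne_of_mem_erase hi), fun j hj hjn => hmin j ?_⟩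
  rw [abs_le] at hjn
  rw [Finset.mem_erase, Finset.mem_Icc]
  omega

theorem exists_gt_fractBelow {α : ℝ} (hα : Irrational α) (n : ℕ) :
    ∃ q : ℕ, n < q ∧ FractBelow α q (q * α) := by
  obtain ⟨ε, hε, hn⟩ := exists_pos_forall_le_fract hα n
  obtain ⟨q, hq, hlt, hbelow⟩ := exists_fract_lt_and_fractBelow hα hε
  refine ⟨q, ?_, hbelow⟩
  by_contra! hqn
  have := hn q (by omega) (by rw [Nat.abs_cast]; exact_mod_cast hqn)
  exact this.not_gt hlt

theorem le_of_mem_records {α : ℝ} {M q : ℕ} (hq : q ∈ records α (-M)) : q ≤ M := by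
  by_contra! h
  have := hq.2 (q - M) (by omega) (by rw [abs_of_pos] <;> omega)
  push_cast at this
  exact this.ne (by ring_nf)

theorem records_infinite {α : ℝ} (hα : Irrational α) : (records α 1).Infinite := by
  refine Set.infinite_of_not_bddAbove fun ⟨b, hb⟩ => ?_
  obtain ⟨q, hq, hbelow⟩ := exists_gt_fractBelow hα (b + 2)
  obtain ⟨p, rfl⟩ : ∃ p, q = p + 1 := ⟨q - 1, by omega⟩
  have : p ∈ records α 1 := ⟨by omega, by exact_mod_cast hbelow⟩
  have := hb this
  omega

section Insert

variable {α : ℝ} {Q : ℕ}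

theorem fract_sub_mul (hα : Irrational α) (hQ : FractBelow α Q (-(Q * α))) {i : ℤ}
    (hi : |i| < Q) : Int.fract ((i - Q) * α) = Int.fract (i * α) + Int.fract (-(Q * α)) := by
  rw [sub_mul, sub_eq_add_neg, fract_add_of_lt]
  rcases eq_or_ne i 0 with rfl | hi0
  · simpa using Int.fract_lt_one _
  · have h := hQ (-i) (neg_ne_zero.2 hi0) (by rwa [abs_neg])
    rw [Int.cast_neg, neg_mul, Int.fract_neg (fract_intCast_mul_pos hα hi0).ne'] at h
    linarith

theorem fract_sub_mul_lt_iff (hα : Irrational α) (hQ : FractBelow α Q (-(Q * α))) {i j : ℤ}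
    (hi : |i| < Q) (hij : |j - i| < Q) :
    Int.fract ((i - Q) * α) < Int.fract (j * α) ↔ Int.fract (i * α) < Int.fract (j * α) := by
  have hη := Int.fract_nonneg (-(Q * α))
  rw [fract_sub_mul hα hQ hi]
  refine ⟨fun h => by linarith, fun h => ?_⟩
  have hne : j - i ≠ 0 := fun h0 => h.ne (by rw [sub_eq_zero.1 h0])
  have hlt := hQ (j - i) hne hij
  rw [Int.cast_sub, sub_mul, fract_sub_of_le h.le] at hlt
  linarith

theorem mem_records_neg_add_iff (hα : Irrational α) (hQ : FractBelow α Q (-(Q * α))) {M q : ℕ}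
    (hMQ : 2 * M < Q) (hq : q ≤ M) :
    q ∈ records α (-(M + Q : ℕ)) ↔ q ∈ records α (-M) := by
  refine and_congr_right fun _ => forall₃_congr fun j _ hjq => ?_
  rw [abs_lt] at hjq
  have := fract_sub_mul_lt_iff hα hQ (i := q - M) (j := j) (by rw [abs_lt]; omega)
    (by rw [abs_lt]; omega)
  push_cast at this ⊢
  rw [show (q : ℝ) + -(M + Q) = q - M - Q by ring, ← sub_eq_add_neg, this]

theorem not_mem_records_neg_add (hα : Irrational α) (hQ : FractBelow α Q (-(Q * α))) {M q : ℕ}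
    (hMq : M < q) (hqQ : q < M + Q) : q ∉ records α (-(M + Q : ℕ)) := by
  intro hq
  have hlt := hq.2 (q - M) (by omega) (by rw [abs_lt]; omega)
  have heq := fract_sub_mul hα hQ (i := q - M) (by rw [abs_lt]; omega)
  have hη := Int.fract_nonneg (-(Q * α))
  push_cast at hlt heq
  rw [show (q : ℝ) + -(M + Q) = q - M - Q by ring] at hlt
  linarith

theorem mem_records_neg_self (hα : Irrational α) {q : ℕ} (hq : 0 < q) : q ∈ records α (-q) := by
  refine ⟨hq, ?_⟩
  rw [Int.cast_neg, Int.cast_natCast, add_neg_cancel, zero_mul]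
  exact fractBelow_zero hα _

theorem records_neg_add (hα : Irrational α) (hQ : FractBelow α Q (-(Q * α))) {M : ℕ}
    (hMQ : 2 * M < Q) : records α (-(M + Q : ℕ)) = insert (M + Q) (records α (-M)) := by
  ext q
  rw [Set.mem_insert_iff]
  rcases le_or_gt q M with hqM | hMq
  · rw [mem_records_neg_add_iff hα hQ hMQ hqM, or_iff_right (by omega)]
  rw [or_iff_left fun hq => hMq.not_ge (le_of_mem_records hq)]
  refine ⟨fun hq => ?_, ?_⟩
  · by_contra hne
    exact not_mem_records_neg_add hα hQ hMq (lt_of_le_of_ne (le_of_mem_records hq) hne) hq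
  · rintro rfl
    exact mem_records_neg_self hα (by omega)

end Insert

theorem exists_encard_records_neg {α : ℝ} (hα : Irrational α) (n : ℕ) :
    ∃ M : ℕ, (records α (-M)).encard = n := by
  induction n with
  | zero =>
    refine ⟨0, Set.encard_eq_zero.2 (Set.eq_empty_of_forall_notMem fun q hq => ?_)⟩
    exact hq.1.not_ge (le_of_mem_records hq)
  | succ n ih =>
    obtain ⟨M, hM⟩ := ih
    obtain ⟨Q, hMQ, hQ⟩ := exists_gt_fractBelow hα.neg (2 * M)
    rw [mul_neg] at hQ
    refine ⟨M + Q, ?_⟩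
    rw [records_neg_add hα hQ.of_neg hMQ, Set.encard_insert_of_notMem, hM, Nat.cast_succ]
    intro hmem
    have := le_of_mem_records hmem
    omega

theorem exists_encard_records_eq {α : ℝ} (hα : Irrational α) (n : ℕ∞) :
    ∃ N : ℤ, (records α N).encard = n := by
  induction n using ENat.recTopCoe with
  | top => exact ⟨1, (records_infinite hα).encard_eq⟩
  | coe n =>
    obtain ⟨M, hM⟩ := exists_encard_records_neg hα n
    exact ⟨-M, hM⟩

/-- The right-infinite word read from position `k` of a bi-infinite word to the right. -/
def rightOf (β : ℤ → Bool) (k : ℤ) : ℕ → Bool := fun i => β (k + i)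

/-- The right-infinite word read from position `k - 1` of a bi-infinite word to the left. -/
def leftOf (β : ℤ → Bool) (k : ℤ) : ℕ → Bool := fun i => β (k - 1 - i)

/-- A bi-infinite binary word is balanced if the numbers of letters `true` in any two factors of
the same length differ by at most one. -/
def IsBalanced (β : ℤ → Bool) : Prop :=
  ∀ (i j : ℤ) (n : ℕ), ∑ k ∈ Finset.range n, (β (i + k)).toNat ≤
    ∑ k ∈ Finset.range n, (β (j + k)).toNat + 1

/-- The letters at positions `k` and `k + 1` are `true` and `false`, and the word is symmetric
about them to depth `m`. -/
def IsMirrored (β : ℤ → Bool) (k : ℤ) (m : ℕ) : Prop :=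
  β k = true ∧ β (k + 1) = false ∧ ∀ i < m, leftOf β k i = rightOf β (k + 2) i

/-- The mechanical word of slope `α` and intercept `ρ`. -/
def mechanical (α ρ : ℝ) : ℤ → Bool :=
  fun i => decide (⌊i * α + ρ⌋ < ⌊(i + 1) * α + ρ⌋)

theorem apply_sub_succ (β : ℤ → Bool) (k : ℤ) (i : ℕ) : β (k - (i + 1 : ℕ)) = leftOf β k i :=
  congrArg β (by push_cast; ring)

theorem apply_add_succ (β : ℤ → Bool) (k : ℤ) (i : ℕ) :
    β (k + 1 + (i + 1 : ℕ)) = rightOf β (k + 2) i :=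
  congrArg β (by push_cast; ring)

theorem isMirrored_succ_iff {β : ℤ → Bool} {k : ℤ} {m : ℕ} :
    IsMirrored β k (m + 1) ↔ IsMirrored β k m ∧ leftOf β k m = rightOf β (k + 2) m := by
  simp only [IsMirrored, Nat.forall_lt_succ_right, and_assoc]

theorem sum_toNat_sub_reflect (β : ℤ → Bool) (a : ℤ) (n : ℕ) :
    ∑ i ∈ Finset.range n, (β (a - i)).toNat =
      ∑ i ∈ Finset.range n, (β (a + 1 - n + i)).toNat := by
  rw [← Finset.sum_range_reflect]
  refine Finset.sum_congr rfl fun i hi => ?_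
  have := Finset.mem_range.1 hi
  congr 2
  omega

namespace IsBalanced

variable {β : ℤ → Bool}

theorem comp_sub (hβ : IsBalanced β) (c : ℤ) : IsBalanced fun i => β (c - i) := by
  intro i j n
  simp only [← sub_sub]
  rw [sum_toNat_sub_reflect, sum_toNat_sub_reflect]
  exact hβ _ _ n

theorem toLex_leftOf_le (hβ : IsBalanced β) {k : ℤ} (hk : β k = true) (hk1 : β (k + 1) = false) :
    toLex (leftOf β k) ≤ toLex (rightOf β (k + 2)) := by
  by_contra! ⟨m, heq, hlt⟩
  obtain ⟨hr, hl⟩ := Bool.lt_iff.1 hlt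
  have hsum : ∑ i ∈ Finset.range m, (rightOf β (k + 2) i).toNat =
      ∑ i ∈ Finset.range m, (leftOf β k i).toNat :=
    Finset.sum_congr rfl fun i hi => congrArg Bool.toNat (heq i (Finset.mem_range.1 hi))
  have hle := hβ (k + 1 - (m + 2 : ℕ)) (k + 1) (m + 2)
  rw [← sum_toNat_sub_reflect] at hle
  simp only [Finset.sum_range_succ' _ (m + 1), apply_sub_succ, apply_add_succ,
    Finset.sum_range_succ] at hle
  change leftOf β k m = true at hl
  change rightOf β (k + 2) m = false at hr
  simp only [hsum, hl, hr, Nat.cast_zero, sub_zero, add_zero, hk, hk1, Bool.toNat_true,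
    Bool.toNat_false] at hle
  omega

theorem toLex_rightOf_le (hβ : IsBalanced β) {k : ℤ} (hk : β k = false) (hk1 : β (k + 1) = true) :
    toLex (rightOf β (k + 2)) ≤ toLex (leftOf β k) := by
  have h := (hβ.comp_sub (2 * k + 1)).toLex_leftOf_le (k := k) (by rw [← hk1]; congr 1; ring)
    (by rw [← hk]; congr 1; ring)
  convert h using 2
  · funext i
    exact congrArg β (by ring)
  · funext i
    exact congrArg β (by ring)

end IsBalanced

section Mechanical

variable {α : ℝ}

theorem floor_add_eq_or (hα0 : 0 ≤ α) (hα1 : α < 1) (x : ℝ) :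
    ⌊x + α⌋ = ⌊x⌋ ∨ ⌊x + α⌋ = ⌊x⌋ + 1 := by
  have h1 : ⌊x⌋ ≤ ⌊x + α⌋ := Int.floor_mono (by linarith)
  have h2 : ⌊x + α⌋ ≤ ⌊x + 1⌋ := Int.floor_mono (by linarith)
  rw [Int.floor_add_one] at h2
  omega

theorem toNat_mechanical (hα0 : 0 ≤ α) (hα1 : α < 1) (ρ : ℝ) (i : ℤ) :
    ((mechanical α ρ i).toNat : ℤ) = ⌊(i + 1) * α + ρ⌋ - ⌊i * α + ρ⌋ := by
  have h := floor_add_eq_or hα0 hα1 (i * α + ρ)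
  rw [show i * α + ρ + α = (i + 1) * α + ρ by ring] at h
  rcases h with h | h <;> simp [mechanical, h]

theorem sum_mechanical (hα0 : 0 ≤ α) (hα1 : α < 1) (ρ : ℝ) (i : ℤ) (n : ℕ) :
    ((∑ k ∈ Finset.range n, (mechanical α ρ (i + k)).toNat : ℕ) : ℤ) =
      ⌊(i + n) * α + ρ⌋ - ⌊i * α + ρ⌋ := by
  have h := Finset.sum_range_sub (fun k : ℕ => ⌊((i + k : ℤ) : ℝ) * α + ρ⌋) n
  push_cast [toNat_mechanical hα0 hα1] at h ⊢
  simpa only [add_assoc, add_zero] using h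

theorem isBalanced_mechanical (hα0 : 0 ≤ α) (hα1 : α < 1) (ρ : ℝ) :
    IsBalanced (mechanical α ρ) := by
  intro i j n
  zify
  have hi := sum_mechanical hα0 hα1 ρ i n
  have hj := sum_mechanical hα0 hα1 ρ j n
  push_cast at hi hj
  rw [hi, hj, show (i + n) * α + ρ = (i * α + ρ) + n * α by ring,
    show (j + n) * α + ρ = (j * α + ρ) + n * α by ring]
  have h1 := Int.le_floor_add_floor (i * α + ρ) (n * α)
  have h2 := Int.le_floor_add (j * α + ρ) (n * α)
  omega

theorem isMirrored_mechanical_iff_floor (hα0 : 0 ≤ α) (hα1 : α < 1) (ρ : ℝ) (k : ℤ) (m : ℕ) :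
    IsMirrored (mechanical α ρ) k m ↔ ∀ n : ℕ, n < m + 1 →
      ⌊(k - n) * α + ρ⌋ + ⌊(k + 2 + n) * α + ρ⌋ = 2 * ⌊(k + 1) * α + ρ⌋ - 1 := by
  have eq_iff (b c : Bool) : b = c ↔ (b.toNat : ℤ) = c.toNat := by decide +revert
  induction m with
  | zero =>
    have h := floor_add_eq_or hα0 hα1 (k * α + ρ)
    have h1 := floor_add_eq_or hα0 hα1 ((k + 1) * α + ρ)
    rw [show k * α + ρ + α = (k + 1) * α + ρ by ring] at h
    rw [show (k + 1) * α + ρ + α = (k + 2) * α + ρ by ring] at h1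
    simp only [IsMirrored, eq_iff, toNat_mechanical hα0 hα1, zero_add, Nat.lt_one_iff, forall_eq]
    push_cast
    rw [show (k : ℝ) + 1 + 1 = k + 2 by ring]
    simp only [Bool.toNat_true, Bool.toNat_false, Nat.cast_one, Nat.cast_zero, not_lt_zero,
      IsEmpty.forall_iff, implies_true, and_true, sub_zero, add_zero]
    omega
  | succ m ih =>
    have h := toNat_mechanical hα0 hα1 ρ (k - 1 - m)
    have h' := toNat_mechanical hα0 hα1 ρ (k + 2 + m)
    push_cast at h h'
    rw [show (k : ℝ) - 1 - m + 1 = k - m by ring, show (k : ℝ) - 1 - m = k - (m + 1) by ring] at h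
    rw [show (k : ℝ) + 2 + m + 1 = k + 2 + (m + 1) by ring] at h'
    simp only [isMirrored_succ_iff, ih, Nat.forall_lt_succ_right (n := m + 1), eq_iff, leftOf,
      rightOf]
    push_cast
    rw [h, h']
    refine and_congr_right fun hm => ?_
    have := hm m m.lt_succ_self
    omega

theorem floor_sub_add_floor_add_eq_iff (x y : ℝ) :
    ⌊x - y⌋ + ⌊x + y⌋ = 2 * ⌊x⌋ - 1 ↔
      Int.fract x < Int.fract y ∧ Int.fract x < Int.fract (-y) := by
  have hsub : ⌊x - y⌋ = ⌊Int.fract x - Int.fract y⌋ + (⌊x⌋ - ⌊y⌋) := by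
    rw [← Int.floor_add_intCast]
    push_cast [Int.fract]
    ring_nf
  have hadd : ⌊x + y⌋ = ⌊Int.fract x + Int.fract y⌋ + (⌊x⌋ + ⌊y⌋) := by
    rw [← Int.floor_add_intCast]
    push_cast [Int.fract]
    ring_nf
  have hx := Int.fract_nonneg x
  have hy := Int.fract_nonneg y
  have hy1 := Int.fract_lt_one y
  rw [hsub, hadd]
  rcases le_or_gt (Int.fract y) (Int.fract x) with hle | hlt
  · have h1 : 0 ≤ ⌊Int.fract x - Int.fract y⌋ := Int.floor_nonneg.2 (sub_nonneg.2 hle)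
    have h2 : 0 ≤ ⌊Int.fract x + Int.fract y⌋ := Int.floor_nonneg.2 (add_nonneg hx hy)
    exact iff_of_false (by omega) fun h => h.1.not_ge hle
  have h1 : ⌊Int.fract x - Int.fract y⌋ = -1 := by
    rw [Int.floor_eq_iff]
    constructor <;> push_cast <;> linarith
  rw [h1, Int.fract_neg (hx.trans_lt hlt).ne', and_iff_right hlt, lt_sub_iff_add_lt]
  have h2 : ⌊Int.fract x + Int.fract y⌋ = 0 ↔ Int.fract x + Int.fract y < 1 := by
    rw [Int.floor_eq_zero_iff, Set.mem_Ico, and_iff_right (add_nonneg hx hy)]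
  rw [← h2]
  omega

theorem isMirrored_mechanical_iff (hα0 : 0 ≤ α) (hα1 : α < 1) (ρ : ℝ) (k : ℤ) (m : ℕ) :
    IsMirrored (mechanical α ρ) k m ↔ FractBelow α (m + 2) ((k + 1) * α + ρ) := by
  have floor_eq_iff (n : ℕ) : ⌊(k - n) * α + ρ⌋ + ⌊(k + 2 + n) * α + ρ⌋ =
      2 * ⌊(k + 1) * α + ρ⌋ - 1 ↔ Int.fract ((k + 1) * α + ρ) < Int.fract ((n + 1) * α) ∧
        Int.fract ((k + 1) * α + ρ) < Int.fract (-((n + 1) * α)) := by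
    rw [← floor_sub_add_floor_add_eq_iff]
    ring_nf
  simp only [isMirrored_mechanical_iff_floor hα0 hα1, floor_eq_iff]
  refine ⟨fun h j hj hjm => ?_, fun h n hn => ⟨?_, ?_⟩⟩
  · obtain ⟨n, rfl | rfl⟩ := j.eq_nat_or_neg <;>
      obtain ⟨n, rfl⟩ : ∃ p, n = p + 1 := ⟨n - 1, by omega⟩
    · rw [abs_lt] at hjm
      have := (h n (by omega)).1
      exact_mod_cast this
    · rw [abs_lt] at hjm
      have := (h n (by omega)).2
      rw [← neg_mul] at this
      exact_mod_cast this
  · have := h (n + 1) (by omega) (by rw [abs_lt]; omega)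
    exact_mod_cast this
  · have := h (-(n + 1)) (by omega) (by rw [abs_lt]; omega)
    rw [← neg_mul]
    exact_mod_cast this

theorem isMirrored_mechanical_natCast_iff (hα0 : 0 ≤ α) (hα1 : α < 1) (N : ℤ) (k : ℕ) :
    IsMirrored (mechanical α (N * α)) k k ↔ k + 1 ∈ records α N := by
  rw [isMirrored_mechanical_iff hα0 hα1, records, Set.mem_ofPred_eq, and_iff_right k.succ_pos]
  push_cast
  rw [← add_mul]

theorem encard_isMirrored_mechanical (hα0 : 0 ≤ α) (hα1 : α < 1) (N : ℤ) :
    {k : ℕ | IsMirrored (mechanical α (N * α)) k k}.encard = (records α N).encard := by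
  rw [← (add_left_injective 1).encard_image]
  congr 1
  ext q
  simp only [isMirrored_mechanical_natCast_iff hα0 hα1]
  refine ⟨?_, fun hq => ⟨q - 1, ?_⟩⟩
  · rintro ⟨k, hk, rfl⟩
    exact hk
  · have := hq.1
    obtain ⟨p, rfl⟩ : ∃ p, q = p + 1 := ⟨q - 1, by omega⟩
    exact ⟨hq, rfl⟩

theorem infinite_isMirrored_mechanical (hα : Irrational α) (hα0 : 0 ≤ α) (hα1 : α < 1) (N : ℤ)
    (m : ℕ) : {k : ℕ | IsMirrored (mechanical α (N * α)) k m}.Infinite := by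
  refine Set.infinite_of_not_bddAbove fun ⟨b, hb⟩ => ?_
  obtain ⟨q, hq, hbelow⟩ := exists_gt_fractBelow hα (b + N.natAbs + m + 2)
  obtain ⟨k, hk⟩ : ∃ k : ℕ, (k : ℤ) + 1 + N = q := ⟨(q - N - 1).toNat, by omega⟩
  have hmem : IsMirrored (mechanical α (N * α)) k m := by
    rw [isMirrored_mechanical_iff hα0 hα1, ← add_mul]
    have hq' : (k : ℝ) + 1 + N = q := by exact_mod_cast hk
    rw [Int.cast_natCast, hq']
    exact hbelow.mono (by omega)
  have := hb hmem
  omega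

theorem isMirrored_mechanical_neg_sub_one (hα : Irrational α) (hα0 : 0 ≤ α) (hα1 : α < 1)
    (N : ℤ) (m : ℕ) : IsMirrored (mechanical α (N * α)) (-N - 1) m := by
  rw [isMirrored_mechanical_iff hα0 hα1]
  convert fractBelow_zero hα _
  push_cast
  ring

theorem abs_sum_mechanical_sub_le (hα0 : 0 ≤ α) (hα1 : α < 1) (ρ : ℝ) (n : ℕ) :
    |((∑ i ∈ Finset.range n, (rightOf (mechanical α ρ) 0 i).toNat : ℕ) : ℝ) - n * α| ≤ 1 := by
  have h := sum_mechanical hα0 hα1 ρ 0 n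
  rw [Int.cast_zero, zero_add, zero_mul, zero_add] at h
  have h' : ((∑ i ∈ Finset.range n, (rightOf (mechanical α ρ) 0 i).toNat : ℕ) : ℝ) =
      ⌊n * α + ρ⌋ - ⌊ρ⌋ := by exact_mod_cast h
  rw [h', abs_le]
  have h1 := Int.floor_le (n * α + ρ)
  have h2 := Int.lt_floor_add_one (n * α + ρ)
  have h3 := Int.floor_le ρ
  have h4 := Int.lt_floor_add_one ρ
  constructor <;> linarith

theorem slope_eq_of_rightOf_mechanical_eq {α' ρ ρ' : ℝ} (hα0 : 0 ≤ α) (hα1 : α < 1)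
    (hα0' : 0 ≤ α') (hα1' : α' < 1)
    (h : rightOf (mechanical α ρ) 0 = rightOf (mechanical α' ρ') 0) : α = α' := by
  by_contra hne
  obtain ⟨n, hn⟩ := exists_nat_gt (2 / |α - α'|)
  rw [div_lt_iff₀ (abs_pos.2 (sub_ne_zero.2 hne))] at hn
  have h1 := abs_sum_mechanical_sub_le hα0 hα1 ρ n
  have h2 := abs_sum_mechanical_sub_le hα0' hα1' ρ' n
  rw [h, abs_sub_comm] at h1
  have htri := abs_sub_le (n * α)
    ((∑ i ∈ Finset.range n, (rightOf (mechanical α' ρ') 0 i).toNat : ℕ) : ℝ) (n * α')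
  rw [← mul_sub, abs_mul, Nat.abs_cast] at htri
  linarith

end Mechanical

section ContinuedFraction

open Filter Topology GenContFract

theorem convs_contFrac (a₀ : ℤ) (a : ℕ → ℕ+) (n : ℕ) :
    (contFrac a₀ a).convs n = a₀ + convs'Aux (contFrac 0 a).s n :=
  congrFun (funext fun _ => convs_eq_convs' fun _ h => by
    obtain rfl := Option.some.inj h
    exact ⟨one_pos, Nat.cast_pos.2 (a _).pos⟩) n

theorem convs_contFrac_succ (a : ℕ → ℕ+) (n : ℕ) :
    (contFrac 0 a).convs (n + 1) =
      1 / ((a 0 : ℕ) + (contFrac 0 fun i => a (i + 1)).convs n) := by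
  simp only [convs_contFrac, Int.cast_zero, zero_add]
  exact convs'Aux_succ_some (p := ⟨1, ((a 0 : ℕ) : ℝ)⟩) rfl n

theorem convs_contFrac_nonneg (a : ℕ → ℕ+) (n : ℕ) : 0 ≤ (contFrac 0 a).convs n := by
  induction n generalizing a with
  | zero => simp [contFrac]
  | succ n ih =>
    rw [convs_contFrac_succ]
    have := ih fun i => a (i + 1)
    positivity

theorem cfValue_eq_add (a₀ : ℤ) (a : ℕ → ℕ+) : cfValue a₀ a = a₀ + cfValue 0 a := by
  refine tendsto_nhds_unique (tendsto_convs a₀ a)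
    (((tendsto_convs 0 a).const_add (a₀ : ℝ)).congr fun n => ?_)
  rw [convs_contFrac a₀, convs_contFrac 0, Int.cast_zero, zero_add]

theorem cfValue_eq_one_div (a : ℕ → ℕ+) :
    cfValue 0 a = 1 / ((a 0 : ℕ) + cfValue 0 fun i => a (i + 1)) := by
  have hnonneg := ge_of_tendsto' (tendsto_convs 0 fun i => a (i + 1))
    (convs_contFrac_nonneg fun i => a (i + 1))
  refine tendsto_nhds_unique ((tendsto_convs 0 a).comp (tendsto_add_atTop_nat 1)) ?_
  exact (tendsto_const_nhds.div ((tendsto_convs 0 _).const_add _) (by positivity)).congr fun n =>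
    (convs_contFrac_succ a n).symm

theorem cfValue_pos (a : ℕ → ℕ+) : 0 < cfValue 0 a := by
  have := ge_of_tendsto' (tendsto_convs 0 fun i => a (i + 1))
    (convs_contFrac_nonneg fun i => a (i + 1))
  rw [cfValue_eq_one_div]
  positivity

theorem cfValue_lt_one (a : ℕ → ℕ+) : cfValue 0 a < 1 := by
  have := cfValue_pos fun i => a (i + 1)
  have := one_le_letter a 0
  rw [cfValue_eq_one_div, div_lt_one (by positivity)]
  linarith

theorem fract_cfValue (a₀ : ℤ) (a : ℕ → ℕ+) : Int.fract (cfValue a₀ a) = cfValue 0 a := by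
  rw [cfValue_eq_add, Int.fract_intCast_add]
  exact Int.fract_eq_self.2 ⟨(cfValue_pos a).le, cfValue_lt_one a⟩

theorem floor_cfValue (a₀ : ℤ) (a : ℕ → ℕ+) : ⌊cfValue a₀ a⌋ = a₀ := by
  rw [cfValue_eq_add, Int.floor_intCast_add,
    Int.floor_eq_zero_iff.2 ⟨(cfValue_pos a).le, cfValue_lt_one a⟩, add_zero]

theorem inv_fract_cfValue (a₀ : ℤ) (a : ℕ → ℕ+) :
    (Int.fract (cfValue a₀ a))⁻¹ = cfValue (a 0 : ℕ) fun i => a (i + 1) := by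
  rw [fract_cfValue, cfValue_eq_one_div, one_div, inv_inv, cfValue_eq_add (a 0 : ℕ),
    Int.cast_natCast]

theorem of_cfValue (a₀ : ℤ) (a : ℕ → ℕ+) : GenContFract.of (cfValue a₀ a) = contFrac a₀ a := by
  have hs (n : ℕ) : (GenContFract.of (cfValue a₀ a)).s.get? n = some ⟨1, ((a n : ℕ) : ℝ)⟩ := by
    induction n generalizing a₀ a with
    | zero =>
      have h := of_s_head (v := cfValue a₀ a) (by rw [fract_cfValue]; exact (cfValue_pos a).ne')
      rwa [inv_fract_cfValue, floor_cfValue, Int.cast_natCast] at h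
    | succ n ih => rw [of_s_succ, inv_fract_cfValue, ih]
  exact GenContFract.ext (by rw [of_h_eq_floor, floor_cfValue]; rfl) (Stream'.Seq.ext hs)

theorem irrational_cfValue (a₀ : ℤ) (a : ℕ → ℕ+) : Irrational (cfValue a₀ a) := by
  rintro ⟨q, hq⟩
  obtain ⟨n, hn⟩ := (terminates_iff_rat (cfValue a₀ a)).2 ⟨q, hq.symm⟩
  rw [of_cfValue] at hn
  exact absurd hn (Option.some_ne_none _)

/-- The tail `[0; a n, a (n + 1), …]` of an infinite continued fraction. -/
def cfTail (a : ℕ → ℕ+) (n : ℕ) : ℝ := cfValue 0 fun i => a (n + i)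

theorem cfTail_pos (a : ℕ → ℕ+) (n : ℕ) : 0 < cfTail a n := cfValue_pos _

theorem cfTail_lt_one (a : ℕ → ℕ+) (n : ℕ) : cfTail a n < 1 := cfValue_lt_one _

theorem cfTail_eq (a : ℕ → ℕ+) (n : ℕ) :
    cfTail a n = 1 / ((a n : ℕ) + cfTail a (n + 1)) := by
  rw [cfTail, cfValue_eq_one_div]
  simp only [cfTail, add_zero, add_assoc, add_comm 1]

variable (a₀ : ℤ) (a : ℕ → ℕ+)

theorem dens_pos (n : ℕ) : 0 < (contFrac a₀ a).dens n :=
  one_pos.trans_le (dens_mono a₀ a n).1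

theorem cfValue_mul_dens_sub_nums_succ (n : ℕ) :
    cfValue a₀ a * (contFrac a₀ a).dens (n + 1) - (contFrac a₀ a).nums (n + 1) =
      -cfTail a (n + 1) * (cfValue a₀ a * (contFrac a₀ a).dens n - (contFrac a₀ a).nums n) := by
  have htail (n : ℕ) : cfTail a n * ((a n : ℕ) + cfTail a (n + 1)) = 1 := by
    have := cfTail_pos a (n + 1)
    rw [cfTail_eq a n]
    field_simp
  induction n with
  | zero =>
    have h0 : cfValue a₀ a = a₀ + cfTail a 0 := by
      rw [cfValue_eq_add, cfTail]
      simp only [zero_add]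
    rw [zero_add, dens_one, nums_one, dens_zero, nums_zero, h0]
    linear_combination htail 0
  | succ n ih =>
    rw [dens_rec, nums_rec]
    linear_combination (a (n + 1) + cfTail a (n + 2)) * ih - (cfValue a₀ a *
      (contFrac a₀ a).dens n - (contFrac a₀ a).nums n) * htail (n + 1)

theorem abs_cfValue_mul_dens_sub_nums (n : ℕ) :
    |cfValue a₀ a * (contFrac a₀ a).dens n - (contFrac a₀ a).nums n| =
      1 / ((contFrac a₀ a).dens (n + 1) + cfTail a (n + 1) * (contFrac a₀ a).dens n) := by
  have hpos : 0 < (contFrac a₀ a).dens (n + 1) + cfTail a (n + 1) * (contFrac a₀ a).dens n := by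
    have := dens_pos a₀ a n
    have := dens_pos a₀ a (n + 1)
    have := cfTail_pos a (n + 1)
    positivity
  rw [eq_div_iff hpos.ne']
  calc _ = |(cfValue a₀ a * (contFrac a₀ a).dens n - (contFrac a₀ a).nums n) *
        ((contFrac a₀ a).dens (n + 1) + cfTail a (n + 1) * (contFrac a₀ a).dens n)| := by
        rw [abs_mul, abs_of_pos hpos]
    _ = |(-1) ^ (n + 1)| := by
        rw [← abs_neg ((-1 : ℝ) ^ (n + 1)), ← nums_dens_det a₀ a n]
        congr 1
        linear_combination (contFrac a₀ a).dens n * cfValue_mul_dens_sub_nums_succ a₀ a n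
    _ = 1 := abs_neg_one_pow _

theorem strictAnti_abs_cfValue_mul_dens_sub_nums :
    StrictAnti fun n =>
      |cfValue a₀ a * (contFrac a₀ a).dens n - (contFrac a₀ a).nums n| := by
  refine strictAnti_nat_of_succ_lt fun n => ?_
  have hpos : 0 < |cfValue a₀ a * (contFrac a₀ a).dens n - (contFrac a₀ a).nums n| := by
    have := dens_pos a₀ a n
    have := dens_pos a₀ a (n + 1)
    have := cfTail_pos a (n + 1)
    rw [abs_cfValue_mul_dens_sub_nums]
    positivity
  rw [cfValue_mul_dens_sub_nums_succ, abs_mul, abs_neg, abs_of_pos (cfTail_pos a _)]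
  exact mul_lt_of_lt_one_left hpos (cfTail_lt_one a _)

theorem exists_int_nums_dens (n : ℕ) :
    ∃ p q : ℤ, (contFrac a₀ a).nums n = p ∧ (contFrac a₀ a).dens n = q := by
  induction n using Nat.twoStepInduction with
  | zero => exact ⟨a₀, 1, nums_zero a₀ a, by rw [dens_zero, Int.cast_one]⟩
  | one => exact ⟨(a 0 : ℕ) * a₀ + 1, (a 0 : ℕ), by rw [nums_one]; push_cast; rfl, dens_one a₀ a⟩
  | more n h h' =>
    obtain ⟨p, q, hp, hq⟩ := h
    obtain ⟨p', q', hp', hq'⟩ := h'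
    refine ⟨(a (n + 1) : ℕ) * p' + p, (a (n + 1) : ℕ) * q' + q, ?_, ?_⟩
    · rw [nums_rec, hp, hp']
      push_cast
      rfl
    · rw [dens_rec, hq, hq']
      push_cast
      rfl

theorem cast_convergent_cfValue (n : ℕ) :
    ((cfValue a₀ a).convergent n : ℝ) = (contFrac a₀ a).nums n / (contFrac a₀ a).dens n := by
  rw [← Real.convs_eq_convergent, of_cfValue]
  rfl

theorem den_convergent_cfValue (n : ℕ) :
    (((cfValue a₀ a).convergent n).den : ℝ) = (contFrac a₀ a).dens n := by
  obtain ⟨p, q, hp, hq⟩ := exists_int_nums_dens a₀ a n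
  obtain ⟨p', q', hp', hq'⟩ := exists_int_nums_dens a₀ a (n + 1)
  have hdet := nums_dens_det a₀ a n
  rw [hp, hq, hp', hq'] at hdet
  have hcop : IsCoprime p q := by
    have hdet' : p * q' - q * p' = (-1) ^ (n + 1) := by exact_mod_cast hdet
    have hsq : ((-1 : ℤ) ^ (n + 1)) * (-1) ^ (n + 1) = 1 := by rw [← mul_pow]; simp
    exact ⟨(-1) ^ (n + 1) * q', -(-1) ^ (n + 1) * p', by
      linear_combination (-1) ^ (n + 1) * hdet' + hsq⟩
  have hq0 : 0 < q := by exact_mod_cast hq ▸ dens_pos a₀ a n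
  have hconv : (cfValue a₀ a).convergent n = p / q := by
    have := cast_convergent_cfValue a₀ a n
    rw [hp, hq] at this
    exact_mod_cast this
  rw [hconv, hq]
  exact_mod_cast Rat.den_div_eq_of_coprime hq0 (Int.isCoprime_iff_gcd_eq_one.1 hcop)

theorem convergent_cfValue_injective : Function.Injective (cfValue a₀ a).convergent := by
  intro m n h
  have hd : (contFrac a₀ a).dens m = (contFrac a₀ a).dens n := by
    rw [← den_convergent_cfValue, ← den_convergent_cfValue, h]
  have hn : (contFrac a₀ a).nums m = (contFrac a₀ a).nums n := by
    have := congrArg ((↑) : ℚ → ℝ) h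
    rwa [cast_convergent_cfValue, cast_convergent_cfValue, hd,
      div_left_inj' (dens_pos a₀ a n).ne'] at this
  refine (strictAnti_abs_cfValue_mul_dens_sub_nums a₀ a).injective ?_
  simp only [hd, hn]

/-- The quality of the `n`-th convergent `p/q` of `x = [a₀; a 0, a 1, …]`: the number `c` for which
`|x - p/q| = 1/(c q²)`. -/
def quality (n : ℕ) : ℝ :=
  (contFrac a₀ a).dens (n + 1) / (contFrac a₀ a).dens n + cfTail a (n + 1)

theorem quality_pos (n : ℕ) : 0 < quality a₀ a n :=
  add_pos (div_pos (dens_pos a₀ a _) (dens_pos a₀ a n)) (cfTail_pos a _)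

theorem abs_cfValue_sub_convergent (n : ℕ) :
    |cfValue a₀ a - (cfValue a₀ a).convergent n| =
      1 / (quality a₀ a n * (((cfValue a₀ a).convergent n).den : ℝ) ^ 2) := by
  have hd := dens_pos a₀ a n
  have hd' := dens_pos a₀ a (n + 1)
  have ht := cfTail_pos a (n + 1)
  have h := abs_cfValue_mul_dens_sub_nums a₀ a n
  rw [cast_convergent_cfValue, den_convergent_cfValue, quality, sub_div' hd.ne', abs_div, h,
    abs_of_pos hd]
  field_simp

variable {a₀ a}

theorem convergent_mem_solutions_iff {c : ℝ} (hc : 0 < c) {n : ℕ} :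
    (cfValue a₀ a).convergent n ∈ solutions c (cfValue a₀ a) ↔ c < quality a₀ a n := by
  have hq := quality_pos a₀ a n
  rw [solutions, Set.mem_ofPred_eq, abs_cfValue_sub_convergent,
    one_div_lt_one_div (by positivity) (by positivity), mul_lt_mul_iff_left₀ (by positivity)]

theorem solutions_cfValue {c : ℝ} (hc : 2 ≤ c) :
    solutions c (cfValue a₀ a) = (cfValue a₀ a).convergent '' {n | c < quality a₀ a n} := by
  ext r
  constructor
  · intro hr
    have hd : 0 < r.den := r.den_pos
    obtain ⟨n, rfl⟩ := Real.exists_rat_eq_convergent (hr.trans_le (by gcongr) :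
      |cfValue a₀ a - r| < 1 / (2 * (r.den : ℝ) ^ 2))
    exact ⟨n, (convergent_mem_solutions_iff (by linarith)).1 hr, rfl⟩
  · rintro ⟨n, hn, rfl⟩
    exact (convergent_mem_solutions_iff (by linarith)).2 hn

theorem encard_solutions_cfValue {c : ℝ} (hc : 2 ≤ c) :
    (solutions c (cfValue a₀ a)).encard = {n | c < quality a₀ a n}.encard := by
  rw [solutions_cfValue hc, (convergent_cfValue_injective a₀ a).encard_image]

theorem lagrangeValue_eq_of_quality {L : ℝ} (hL : 2 < L)
    (hfin : ∀ c > L, {n | c < quality a₀ a n}.Finite)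
    (hinf : ∀ c < L, {n | c < quality a₀ a n}.Infinite) : lagrangeValue (cfValue a₀ a) = L := by
  refine le_antisymm (iSup₂_le fun c hc => ?_) (le_of_forall_lt fun y hy => ?_)
  · rw [EReal.coe_le_coe_iff]
    by_contra! hLc
    refine hc.2 ?_
    rw [solutions_cfValue (hL.trans hLc).le]
    exact (hfin c hLc).image _
  · obtain ⟨c, hyc, hcL⟩ := EReal.lt_iff_exists_real_btwn.1
      (max_lt hy (EReal.coe_lt_coe_iff.2 hL))
    obtain ⟨hyc, hc⟩ := max_lt_iff.1 hyc
    rw [EReal.coe_lt_coe_iff] at hcL hc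
    refine hyc.trans_le (le_iSup₂_of_le c ⟨two_pos.trans hc, ?_⟩ le_rfl)
    rw [solutions_cfValue hc.le]
    exact (hinf c hcL).image (convergent_cfValue_injective a₀ a).injOn

end ContinuedFraction

section DoubledWords

/-- The digit coded by a letter: `2` for `true` and `1` for `false`. -/
def digit (b : Bool) : ℕ+ := bif b then 2 else 1

theorem coe_digit_true : ((digit true : ℕ) : ℝ) = 2 := rfl

theorem coe_digit_false : ((digit false : ℕ) : ℝ) = 1 := Nat.cast_one

/-- The sequence of digits in which every letter of a binary word is repeated twice. -/
def dbl (s : ℕ → Bool) : ℕ → ℕ+ := fun i => digit (s (i / 2))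

/-- The continued fraction `[0; d₀, d₀, d₁, d₁, …]`, where `dᵢ` is the digit coded by `s i`. -/
def dblVal (s : ℕ → Bool) : ℝ := cfValue 0 (dbl s)

/-- The map `t ↦ [0; d, d + t]`, where `d` is the digit coded by `b`. -/
def dblStep (b : Bool) (t : ℝ) : ℝ := 1 / ((digit b : ℕ) + 1 / ((digit b : ℕ) + t))

/-- The value `[0; d₀, d₀, …, dₙ₋₁, dₙ₋₁ + t]` (and `t` if `n = 0`), where `dᵢ` is the digit coded
by `s i`. -/
def evalPrefix : (ℕ → Bool) → ℕ → ℝ → ℝ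
  | _, 0, t => t
  | s, n + 1, t => dblStep (s 0) (evalPrefix (fun i => s (i + 1)) n t)

theorem dblVal_pos (s : ℕ → Bool) : 0 < dblVal s := cfValue_pos _

theorem dblVal_lt_one (s : ℕ → Bool) : dblVal s < 1 := cfValue_lt_one _

theorem cfTail_dbl_even (s : ℕ → Bool) (k : ℕ) :
    cfTail (dbl s) (2 * k) = dblVal fun i => s (k + i) :=
  congrArg (cfValue 0) (funext fun i => congrArg (digit ∘ s) (by omega))

theorem cfTail_dbl_odd (s : ℕ → Bool) (k : ℕ) :
    cfTail (dbl s) (2 * k + 1) = 1 / ((digit (s k) : ℕ) + dblVal fun i => s (k + 1 + i)) := by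
  have hdiv : (2 * k + 1) / 2 = k := by omega
  rw [cfTail_eq, ← cfTail_dbl_even, dbl, hdiv]
  rfl

theorem dblVal_eq_dblStep (s : ℕ → Bool) : dblVal s = dblStep (s 0) (dblVal fun i => s (i + 1)) :=
  calc dblVal s = cfTail (dbl s) (2 * 0) := by simp only [cfTail_dbl_even, zero_add]
    _ = 1 / ((digit (s 0) : ℕ) + cfTail (dbl s) (2 * 0 + 1)) := cfTail_eq _ _
    _ = dblStep (s 0) (dblVal fun i => s (i + 1)) := by
      simp only [cfTail_dbl_odd, dblStep, zero_add, add_comm 1]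

theorem dblVal_eq_evalPrefix (s : ℕ → Bool) (n : ℕ) :
    dblVal s = evalPrefix s n (dblVal fun i => s (n + i)) := by
  induction n generalizing s with
  | zero => simp only [zero_add, evalPrefix]
  | succ n ih =>
    rw [dblVal_eq_dblStep, evalPrefix, ih]
    simp only [add_right_comm n 1]

theorem dblStep_pos (b : Bool) {t : ℝ} (ht : 0 ≤ t) : 0 < dblStep b t := by
  rw [dblStep]
  positivity

theorem dblStep_strictMonoOn (b : Bool) : StrictMonoOn (dblStep b) (Set.Ici 0) := by
  intro t ht u hu htu
  rw [Set.mem_Ici] at ht hu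
  rw [dblStep, dblStep]
  gcongr

theorem dblStep_true_lt_half {t : ℝ} (ht : 0 ≤ t) : dblStep true t < 1 / 2 := by
  rw [dblStep, coe_digit_true]
  have : 0 < 1 / (2 + t) := by positivity
  gcongr
  linarith

theorem half_le_dblStep_false {t : ℝ} (ht : 0 ≤ t) : 1 / 2 ≤ dblStep false t := by
  rw [dblStep, coe_digit_false]
  have : 1 / (1 + t) ≤ 1 := (div_le_one (by positivity)).2 (by linarith)
  gcongr
  linarith

theorem one_le_digit (b : Bool) : (1 : ℝ) ≤ (digit b : ℕ) := by
  exact_mod_cast (digit b).pos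

theorem dblStep_lt_one (b : Bool) {t : ℝ} (ht : 0 ≤ t) : dblStep b t < 1 := by
  have hd := one_le_digit b
  have : 0 < 1 / ((digit b : ℕ) + t) := by positivity
  rw [dblStep, div_lt_one (by positivity)]
  linarith

theorem abs_dblStep_sub_dblStep_le (b : Bool) {t u : ℝ} (ht : 0 ≤ t) (hu : 0 ≤ u) :
    |dblStep b t - dblStep b u| ≤ 1 / 4 * |t - u| := by
  have hd := one_le_digit b
  rw [dblStep, dblStep]
  set d := ((digit b : ℕ) : ℝ)
  have hdt : 2 ≤ d * (d + t) + 1 := by nlinarith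
  have hdu : 2 ≤ d * (d + u) + 1 := by nlinarith
  have heq : 1 / (d + 1 / (d + t)) - 1 / (d + 1 / (d + u)) =
      (t - u) / ((d * (d + t) + 1) * (d * (d + u) + 1)) := by
    field_simp
    ring
  rw [heq, abs_div, abs_of_pos (by positivity : 0 < (d * (d + t) + 1) * (d * (d + u) + 1)),
    one_div_mul_eq_div]
  gcongr
  nlinarith

theorem evalPrefix_nonneg (s : ℕ → Bool) (n : ℕ) {t : ℝ} (ht : 0 ≤ t) : 0 ≤ evalPrefix s n t := by
  induction n generalizing s with
  | zero => exact ht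
  | succ n ih => exact (dblStep_pos _ (ih _)).le

theorem evalPrefix_zero_le_one (s : ℕ → Bool) (n : ℕ) : evalPrefix s n 0 ≤ 1 := by
  cases n with
  | zero => exact zero_le_one
  | succ n => exact (dblStep_lt_one _ (evalPrefix_nonneg _ n le_rfl)).le

theorem evalPrefix_lt_evalPrefix {r s : ℕ → Bool} {m n n' : ℕ} {t u : ℝ} (ht : 0 ≤ t) (hu : 0 ≤ u)
    (heq : ∀ i < m, r i = s i) (hr : r m = true) (hs : s m = false) (hn : m < n) (hn' : m < n') :
    evalPrefix r n t < evalPrefix s n' u := by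
  obtain ⟨n, rfl⟩ := Nat.exists_eq_add_of_lt hn
  obtain ⟨n', rfl⟩ := Nat.exists_eq_add_of_lt hn'
  induction m generalizing r s with
  | zero =>
    rw [evalPrefix, evalPrefix, hr, hs]
    exact (dblStep_true_lt_half (evalPrefix_nonneg _ _ ht)).trans_le
      (half_le_dblStep_false (evalPrefix_nonneg _ _ hu))
  | succ m ih =>
    rw [evalPrefix, evalPrefix, heq 0 m.succ_pos]
    rw [add_right_comm m 1, add_right_comm m 1]
    exact dblStep_strictMonoOn _ (evalPrefix_nonneg _ _ ht) (evalPrefix_nonneg _ _ hu)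
      (ih (fun i hi => heq (i + 1) (by omega)) hr hs (by omega) (by omega))

theorem dblVal_lt_dblVal_of_toLex_lt {r s : ℕ → Bool} (h : toLex r < toLex s) :
    dblVal s < dblVal r := by
  obtain ⟨m, heq, hlt⟩ := h
  obtain ⟨hr, hs⟩ := Bool.lt_iff.1 hlt
  rw [dblVal_eq_evalPrefix s (m + 1), dblVal_eq_evalPrefix r (m + 1)]
  exact evalPrefix_lt_evalPrefix (dblVal_pos _).le (dblVal_pos _).le
    (fun i hi => (heq i hi).symm) hs hr m.lt_succ_self m.lt_succ_self

theorem dblVal_le_dblVal_of_toLex_le {r s : ℕ → Bool} (h : toLex r ≤ toLex s) :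
    dblVal s ≤ dblVal r := by
  rcases h.eq_or_lt with heq | hlt
  · rw [toLex_inj.1 heq]
  · exact (dblVal_lt_dblVal_of_toLex_lt hlt).le

theorem dblVal_injective : Function.Injective dblVal := by
  intro r s h
  by_contra hne
  rcases lt_or_gt_of_ne (toLex_inj.not.2 hne) with hlt | hlt
  · exact (dblVal_lt_dblVal_of_toLex_lt hlt).ne' h
  · exact (dblVal_lt_dblVal_of_toLex_lt hlt).ne h

theorem evalPrefix_zero_lt_dblVal_of_eq {r s : ℕ → Bool} {n : ℕ} (h : ∀ i < n, r i = s i) :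
    evalPrefix r n 0 < dblVal s := by
  induction n generalizing r s with
  | zero => exact dblVal_pos s
  | succ n ih =>
    rw [dblVal_eq_dblStep, evalPrefix, h 0 n.succ_pos]
    exact dblStep_strictMonoOn _ (evalPrefix_nonneg _ _ le_rfl) (dblVal_pos _).le
      (ih fun i hi => h (i + 1) (by omega))

theorem evalPrefix_zero_lt_dblVal_of_toLex_le {r s : ℕ → Bool} (h : toLex s ≤ toLex r) (n : ℕ) :
    evalPrefix r n 0 < dblVal s := by
  by_cases heq : ∀ i < n, r i = s i
  · exact evalPrefix_zero_lt_dblVal_of_eq heq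
  obtain ⟨m, hm, hlt⟩ := h.lt_of_ne fun h' => heq fun i _ => congrFun (toLex_inj.1 h').symm i
  obtain ⟨hs, hr⟩ := Bool.lt_iff.1 hlt
  have hmn : m < n := by
    by_contra! hnm
    exact heq fun i hi => (hm i (hi.trans_le hnm)).symm
  rw [dblVal_eq_evalPrefix s (m + 1)]
  exact evalPrefix_lt_evalPrefix le_rfl (dblVal_pos _).le (fun i hi => (hm i hi).symm) hr hs hmn
    m.lt_succ_self

theorem evalPrefix_zero_lt_dblVal_iff {r s : ℕ → Bool} (h : toLex r ≤ toLex s) {n : ℕ} :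
    evalPrefix r n 0 < dblVal s ↔ ∀ i < n, r i = s i := by
  refine ⟨fun hlt => ?_, evalPrefix_zero_lt_dblVal_of_eq⟩
  by_contra hne
  obtain ⟨m, hm, hlt'⟩ := h.lt_of_ne fun h' => hne fun i _ => congrFun (toLex_inj.1 h') i
  obtain ⟨hr, hs⟩ := Bool.lt_iff.1 hlt'
  have hmn : m < n := by
    by_contra! hnm
    exact hne fun i hi => hm i (hi.trans_le hnm)
  rw [dblVal_eq_evalPrefix s (m + 1)] at hlt
  exact hlt.not_gt (evalPrefix_lt_evalPrefix (dblVal_pos _).le le_rfl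
    (fun i hi => (hm i hi).symm) hs hr m.lt_succ_self hmn)

theorem abs_evalPrefix_zero_sub_dblVal_le {r s : ℕ → Bool} {m n : ℕ} (h : ∀ i < m, r i = s i)
    (hmn : m ≤ n) : |evalPrefix r n 0 - dblVal s| ≤ (1 / 4) ^ m := by
  induction m generalizing r s n with
  | zero =>
    rw [pow_zero, abs_le]
    constructor <;> linarith [dblVal_pos s, dblVal_lt_one s, evalPrefix_nonneg r n le_rfl,
      evalPrefix_zero_le_one r n]
  | succ m ih =>
    obtain ⟨n, rfl⟩ : ∃ p, n = p + 1 := ⟨n - 1, by omega⟩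
    rw [evalPrefix, dblVal_eq_dblStep, h 0 m.succ_pos, pow_succ']
    refine (abs_dblStep_sub_dblStep_le _ (evalPrefix_nonneg _ _ le_rfl) (dblVal_pos _).le).trans ?_
    gcongr
    exact ih (fun i hi => h (i + 1) (by omega)) (by omega)

end DoubledWords

section Qualities

variable {β : ℤ → Bool}

/-- The value `d + 1 / (d + t) + u` of a continued fraction `[d; d, …]` with tail `t` after a block
`d, d`, plus a backward continued fraction `u`, where `d` is the digit coded by `b`. -/
def blockHeight (b : Bool) (t u : ℝ) : ℝ := (digit b : ℕ) + 1 / ((digit b : ℕ) + t) + u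

theorem blockHeight_true_dblStep_false {u : ℝ} (t : ℝ) (hu : 0 ≤ u) :
    blockHeight true t (dblStep false u) = 3 + (1 / (2 + t) - 1 / (2 + u)) := by
  have hstep : dblStep false u = 1 - 1 / (2 + u) := by
    rw [dblStep, coe_digit_false]
    field_simp
    ring
  rw [blockHeight, hstep, coe_digit_true]
  ring

theorem blockHeight_lt_three {t u : ℝ} {b c : Bool} (ht : 0 ≤ t) (hu : 0 ≤ u)
    (h : b = false ∨ c = true) : blockHeight b t (dblStep c u) < 3 := by
  rw [blockHeight]
  cases b with
  | false =>
    have : 1 / (1 + t) ≤ 1 := (div_le_one (by positivity)).2 (by linarith)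
    have := dblStep_lt_one c hu
    rw [coe_digit_false]
    linarith
  | true =>
    obtain rfl : c = true := by simpa only [Bool.true_eq_false, false_or] using h
    have : 1 / (2 + t) ≤ 1 / 2 := by
      gcongr
      linarith
    have := dblStep_true_lt_half hu
    rw [coe_digit_true]
    linarith

theorem three_lt_blockHeight_dblStep_iff {b c : Bool} {t u : ℝ} (ht : 0 ≤ t) (hu : 0 ≤ u) :
    3 < blockHeight b t (dblStep c u) ↔ b = true ∧ c = false ∧ t < u := by
  by_cases h : b = false ∨ c = true
  · refine iff_of_false (blockHeight_lt_three ht hu h).not_gt ?_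
    rintro ⟨rfl, rfl, -⟩
    simp only [Bool.true_eq_false, Bool.false_eq_true, or_self] at h
  obtain ⟨rfl, rfl⟩ : b = true ∧ c = false := by
    simpa only [not_or, Bool.not_eq_false, Bool.not_eq_true] using h
  rw [blockHeight_true_dblStep_false t hu, lt_add_iff_pos_right, sub_pos,
    one_div_lt_one_div (by positivity) (by positivity), add_lt_add_iff_left]
  simp only [true_and]

theorem blockHeight_zero_right_le {t : ℝ} (b : Bool) (ht : 0 ≤ t) : blockHeight b t 0 ≤ 3 := by
  have hd := one_le_digit b
  have hd' : ((digit b : ℕ) : ℝ) ≤ 2 := by cases b <;> norm_num [digit]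
  have : 1 / ((digit b : ℕ) + t) ≤ 1 := (div_le_one (by positivity)).2 (by linarith)
  rw [blockHeight]
  linarith

theorem abs_blockHeight_true_dblStep_false_sub_three_le {t u : ℝ} (ht : 0 ≤ t) (hu : 0 ≤ u) :
    |blockHeight true t (dblStep false u) - 3| ≤ |t - u| := by
  have heq : 1 / (2 + t) - 1 / (2 + u) = (u - t) / ((2 + t) * (2 + u)) := by
    field_simp
    ring
  rw [blockHeight_true_dblStep_false t hu, add_sub_cancel_left, heq, abs_div, abs_sub_comm u,
    abs_of_pos (by positivity : 0 < (2 + t) * (2 + u))]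
  exact div_le_self (abs_nonneg _) (by nlinarith)

theorem rightOf_add (β : ℤ → Bool) (k : ℤ) (n : ℕ) :
    (fun i => rightOf β k (n + i)) = rightOf β (k + n) :=
  funext fun i => congrArg β (by push_cast; ring)

theorem dblVal_rightOf (β : ℤ → Bool) (k : ℤ) :
    dblVal (rightOf β k) = dblStep (β k) (dblVal (rightOf β (k + 1))) := by
  have h := rightOf_add β k 1
  simp only [add_comm 1, Nat.cast_one] at h
  rw [dblVal_eq_dblStep, h, rightOf, Nat.cast_zero, add_zero]

theorem leftOf_succ (β : ℤ → Bool) (k : ℤ) : (fun i => leftOf β k (i + 1)) = leftOf β (k - 1) :=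
  funext fun i => congrArg β (by push_cast; ring)

theorem leftOf_apply_zero (β : ℤ → Bool) (k : ℤ) : leftOf β k 0 = β (k - 1) :=
  congrArg β (sub_zero _)

theorem dblVal_leftOf (β : ℤ → Bool) (k : ℤ) :
    dblVal (leftOf β k) = dblStep (β (k - 1)) (dblVal (leftOf β (k - 1))) := by
  rw [dblVal_eq_dblStep, leftOf_succ, leftOf_apply_zero]

/-- The value `[0; dₖ₋₁, dₖ₋₁, …, d₀, d₀]`, where `dᵢ` is the digit coded by `β i`; it is the
backward part of the quality of a convergent. -/
def backPrefix (β : ℤ → Bool) (k : ℕ) : ℝ := evalPrefix (leftOf β k) k 0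

theorem backPrefix_succ (β : ℤ → Bool) (k : ℕ) :
    backPrefix β (k + 1) = dblStep (β k) (backPrefix β k) := by
  rw [backPrefix, evalPrefix, leftOf_succ, leftOf_apply_zero, Nat.cast_succ, add_sub_cancel_right,
    backPrefix]

theorem backPrefix_nonneg (β : ℤ → Bool) (k : ℕ) : 0 ≤ backPrefix β k :=
  evalPrefix_nonneg _ _ le_rfl

theorem dens_div_dens_succ (a₀ : ℤ) (a : ℕ → ℕ+) (n : ℕ) :
    (contFrac a₀ a).dens (n + 2) / (contFrac a₀ a).dens (n + 1) =
      (a (n + 1) : ℕ) + 1 / ((contFrac a₀ a).dens (n + 1) / (contFrac a₀ a).dens n) := by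
  have := dens_pos a₀ a n
  have := dens_pos a₀ a (n + 1)
  rw [dens_rec]
  field_simp

theorem dbl_rightOf_even (β : ℤ → Bool) (k : ℕ) : dbl (rightOf β 0) (2 * k) = digit (β k) := by
  rw [dbl, rightOf, zero_add, Nat.mul_div_cancel_left k two_pos]

theorem dbl_rightOf_odd (β : ℤ → Bool) (k : ℕ) : dbl (rightOf β 0) (2 * k + 1) = digit (β k) := by
  rw [dbl, rightOf, zero_add, (by omega : (2 * k + 1) / 2 = k)]

theorem dens_div_dens_even (β : ℤ → Bool) (k : ℕ) :
    (contFrac 0 (dbl (rightOf β 0))).dens (2 * k + 1) /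
      (contFrac 0 (dbl (rightOf β 0))).dens (2 * k) = (digit (β k) : ℕ) + backPrefix β k := by
  induction k with
  | zero =>
    have h := dbl_rightOf_even β 0
    rw [mul_zero] at h
    rw [mul_zero, zero_add, dens_one, dens_zero, div_one, h, backPrefix, evalPrefix, add_zero]
  | succ k ih =>
    have h := dens_div_dens_succ 0 (dbl (rightOf β 0)) (2 * k + 1)
    rw [dens_div_dens_succ _ _ (2 * k), ih, dbl_rightOf_odd, add_assoc _ 1 1, one_add_one_eq_two,
      ← mul_add_one, dbl_rightOf_even] at h
    rw [backPrefix_succ, dblStep]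
    exact h

theorem quality_even (β : ℤ → Bool) (k : ℕ) :
    quality 0 (dbl (rightOf β 0)) (2 * k) =
      blockHeight (β k) (dblVal (rightOf β (k + 1))) (backPrefix β k) := by
  rw [quality, dens_div_dens_even, cfTail_dbl_odd, rightOf_add, blockHeight, rightOf]
  simp only [zero_add, Nat.cast_succ]
  ring

theorem quality_odd (β : ℤ → Bool) (k : ℕ) :
    quality 0 (dbl (rightOf β 0)) (2 * k + 1) =
      blockHeight (β k) (backPrefix β k) (dblVal (rightOf β (k + 1))) := by
  rw [quality, dens_div_dens_succ, dens_div_dens_even, dbl_rightOf_odd,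
    (by ring : 2 * k + 1 + 1 = 2 * (k + 1)), cfTail_dbl_even, rightOf_add, zero_add,
    Nat.cast_succ, blockHeight]

theorem quality_even_le (hβ : IsBalanced β) (k : ℕ) :
    quality 0 (dbl (rightOf β 0)) (2 * k) ≤ 3 := by
  rw [quality_even]
  cases k with
  | zero => exact blockHeight_zero_right_le _ (dblVal_pos _).le
  | succ k =>
    rw [backPrefix_succ, ← not_lt, three_lt_blockHeight_dblStep_iff (dblVal_pos _).le
      (backPrefix_nonneg _ _), Nat.cast_succ, add_assoc]
    rintro ⟨hk1, hk, hlt⟩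
    exact hlt.not_gt (evalPrefix_zero_lt_dblVal_of_toLex_le (hβ.toLex_rightOf_le hk hk1) k)

theorem three_lt_quality_odd_iff (hβ : IsBalanced β) (k : ℕ) :
    3 < quality 0 (dbl (rightOf β 0)) (2 * k + 1) ↔ IsMirrored β k k := by
  rw [quality_odd, dblVal_rightOf, three_lt_blockHeight_dblStep_iff (backPrefix_nonneg _ _)
    (dblVal_pos _).le, add_assoc, IsMirrored]
  exact and_congr_right fun hk => and_congr_right fun hk1 =>
    evalPrefix_zero_lt_dblVal_iff (hβ.toLex_leftOf_le hk hk1)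

theorem abs_quality_odd_sub_three_le {k m : ℕ} (h : IsMirrored β k m) (hmk : m ≤ k) :
    |quality 0 (dbl (rightOf β 0)) (2 * k + 1) - 3| ≤ (1 / 4) ^ m := by
  obtain ⟨hk, hk1, heq⟩ := h
  rw [quality_odd, dblVal_rightOf, hk, hk1, add_assoc]
  exact (abs_blockHeight_true_dblStep_false_sub_three_le (backPrefix_nonneg _ _)
    (dblVal_pos _).le).trans (abs_evalPrefix_zero_sub_dblVal_le heq hmk)

theorem encard_solutions_three_dblVal (hβ : IsBalanced β) :
    (solutions 3 (dblVal (rightOf β 0))).encard = {k : ℕ | IsMirrored β k k}.encard := by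
  have hset : {n | 3 < quality 0 (dbl (rightOf β 0)) n} =
      (fun k => 2 * k + 1) '' {k : ℕ | IsMirrored β k k} := by
    ext n
    constructor
    · intro hn
      obtain ⟨k, rfl | rfl⟩ := n.even_or_odd'
      · exact absurd hn (quality_even_le hβ k).not_gt
      · exact ⟨k, (three_lt_quality_odd_iff hβ k).1 hn, rfl⟩
    · rintro ⟨k, hk, rfl⟩
      exact (three_lt_quality_odd_iff hβ k).2 hk
  have hinj : Function.Injective fun k : ℕ => 2 * k + 1 := fun i j h => by
    simpa only [add_left_inj, mul_right_inj' two_ne_zero] using h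
  rw [dblVal, encard_solutions_cfValue (by norm_num), hset, hinj.encard_image]

theorem lagrangeValue_dblVal (hβ : IsBalanced β) (h : ∀ m, {k : ℕ | IsMirrored β k m}.Infinite) :
    lagrangeValue (dblVal (rightOf β 0)) = 3 := by
  have hpow {ε : ℝ} (hε : 0 < ε) : ∃ m : ℕ, (1 / 4) ^ m < ε :=
    exists_pow_lt_of_lt_one hε (by norm_num)
  refine lagrangeValue_eq_of_quality (L := 3) (by norm_num) (fun c hc => ?_) fun c hc => ?_
  · obtain ⟨m, hm⟩ := hpow (sub_pos.2 hc)
    refine (Set.finite_lt_nat (2 * m)).subset fun n hn => ?_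
    obtain ⟨k, rfl | rfl⟩ := n.even_or_odd'
    · exact absurd (hc.lt.trans hn) (quality_even_le hβ k).not_gt
    have hmir := (three_lt_quality_odd_iff hβ k).1 (hc.lt.trans hn)
    have hle := (abs_le.1 (abs_quality_odd_sub_three_le hmir le_rfl)).2
    have hlt : (1 / 4 : ℝ) ^ m < (1 / 4) ^ k := by
      have : c < _ := hn
      linarith
    have := (pow_lt_pow_iff_right_of_lt_one₀ (by norm_num) (by norm_num)).1 hlt
    simp only [Set.mem_ofPred_eq]
    omega
  · obtain ⟨m, hm⟩ := hpow (sub_pos.2 hc)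
    refine Set.infinite_of_injOn_mapsTo (f := fun k => 2 * k + 1)
      (s := {k : ℕ | IsMirrored β k m} \ {k | k < m}) (fun i _ j _ h => ?_) ?_
      ((h m).sdiff (Set.finite_lt_nat m))
    · simpa only [add_left_inj, mul_right_inj' two_ne_zero] using h
    · rintro k ⟨hk, hmk⟩
      have := (abs_le.1 (abs_quality_odd_sub_three_le hk (not_lt.1 hmk))).1
      simp only [Set.mem_ofPred_eq]
      linarith

end Qualities

section Heights

variable {β : ℤ → Bool}

/-- The bi-infinite word of digits in which every letter of a binary word is repeated twice. -/
def biDbl (β : ℤ → Bool) : BiWord := fun i => digit (β (i / 2))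

theorem cfValue_proj_biDbl (β : ℤ → Bool) : cfValue 0 (proj (biDbl β)) = dblVal (rightOf β 0) :=
  congrArg (cfValue 0) (funext fun i => congrArg (digit ∘ β) (by push_cast; ring))

theorem height_shift_even (β : ℤ → Bool) (k : ℤ) :
    height (shift (2 * k) (biDbl β)) =
      blockHeight (β k) (dblVal (rightOf β (k + 1))) (dblVal (leftOf β k)) := by
  have hright : (fun i : ℕ => biDbl β (2 * k + (i + 1))) =
      fun i => dbl (rightOf β k) (2 * 0 + 1 + i) :=
    funext fun i => congrArg (digit ∘ β) (by omega)
  have hleft : (fun i : ℕ => biDbl β (2 * k + -(i + 1))) = dbl (leftOf β k) :=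
    funext fun i => congrArg (digit ∘ β) (by omega)
  have hk : biDbl β (2 * k + 0) = digit (β k) := congrArg (digit ∘ β) (by omega)
  have hk' : rightOf β k 0 = β k := congrArg β (add_zero k)
  simp only [height, shift]
  rw [hright, hleft, hk, cfValue_eq_add, ← cfTail, cfTail_dbl_odd, rightOf_add, hk', blockHeight,
    dblVal]
  push_cast
  rfl

theorem height_shift_odd (β : ℤ → Bool) (k : ℤ) :
    height (shift (2 * k + 1) (biDbl β)) =
      blockHeight (β k) (dblVal (leftOf β k)) (dblVal (rightOf β (k + 1))) := by
  have hright : (fun i : ℕ => biDbl β (2 * k + 1 + (i + 1))) = dbl (rightOf β (k + 1)) :=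
    funext fun i => congrArg (digit ∘ β) (by omega)
  have hleft : (fun i : ℕ => biDbl β (2 * k + 1 + -(i + 1))) =
      fun i => dbl (leftOf β (k + 1)) (2 * 0 + 1 + i) :=
    funext fun i => congrArg (digit ∘ β) (by omega)
  have hk : biDbl β (2 * k + 1 + 0) = digit (β k) := congrArg (digit ∘ β) (by omega)
  have hleft' : (fun i => leftOf β (k + 1) (0 + 1 + i)) = leftOf β k :=
    funext fun i => congrArg β (by push_cast; ring)
  simp only [height, shift]
  rw [hright, hleft, hk, cfValue_eq_add, ← cfTail, cfTail_dbl_odd, hleft', leftOf_apply_zero,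
    add_sub_cancel_right, blockHeight, dblVal, dblVal]
  push_cast
  ring

theorem height_shift_biDbl_le (hβ : IsBalanced β) (n : ℤ) : height (shift n (biDbl β)) ≤ 3 := by
  rw [← not_lt]
  obtain ⟨k, rfl | rfl⟩ := n.even_or_odd'
  · obtain ⟨k, rfl⟩ : ∃ j, k = j + 1 := ⟨k - 1, by ring⟩
    rw [height_shift_even, dblVal_leftOf, add_sub_cancel_right, add_assoc,
      three_lt_blockHeight_dblStep_iff (dblVal_pos _).le (dblVal_pos _).le]
    rintro ⟨hk1, hk, hlt⟩
    exact hlt.not_ge (dblVal_le_dblVal_of_toLex_le (hβ.toLex_rightOf_le hk hk1))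
  · rw [height_shift_odd, dblVal_rightOf, add_assoc,
      three_lt_blockHeight_dblStep_iff (dblVal_pos _).le (dblVal_pos _).le]
    rintro ⟨hk, hk1, hlt⟩
    exact hlt.not_ge (dblVal_le_dblVal_of_toLex_le (hβ.toLex_leftOf_le hk hk1))

theorem height_shift_odd_of_isMirrored {k : ℤ} (h : ∀ m, IsMirrored β k m) :
    height (shift (2 * k + 1) (biDbl β)) = 3 := by
  obtain ⟨hk, hk1, -⟩ := h 0
  have heq : leftOf β k = rightOf β (k + 2) := funext fun i => (h (i + 1)).2.2 i i.lt_succ_self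
  rw [height_shift_odd, dblVal_rightOf, add_assoc, hk, hk1, heq]
  exact (blockHeight_true_dblStep_false _ (dblVal_pos _).le).trans
    (by rw [one_add_one_eq_two]; ring)

theorem markovValue_biDbl (hβ : IsBalanced β) {k : ℤ} (h : ∀ m, IsMirrored β k m) :
    markovValue (biDbl β) = 3 := by
  refine le_antisymm (iSup_le fun n => ?_) (le_iSup_of_le (2 * k + 1) ?_)
  · exact EReal.coe_le_coe_iff.2 (height_shift_biDbl_le hβ n)
  · rw [height_shift_odd_of_isMirrored h]
    rfl

end Heights

/-- The value of the doubled right half of the mechanical word of slope `α` and intercept `N α`. -/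
def sturmianValue (α : ℝ) (N : ℤ) : ℝ := dblVal (rightOf (mechanical α (N * α)) 0)

theorem sturmianValue_mem_Y3 {α : ℝ} (hα : Irrational α) (hα0 : 0 ≤ α) (hα1 : α < 1) (N : ℤ) :
    sturmianValue α N ∈ Y3 (records α N).encard := by
  have hβ := isBalanced_mechanical hα0 hα1 (N * α)
  refine ⟨⟨irrational_cfValue _ _, ?_, ?_⟩, biDbl (mechanical α (N * α)), ?_, ?_⟩
  · exact lagrangeValue_dblVal hβ (infinite_isMirrored_mechanical hα hα0 hα1 N)
  · exact (encard_solutions_three_dblVal hβ).trans (encard_isMirrored_mechanical hα0 hα1 N)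
  · exact markovValue_biDbl hβ (isMirrored_mechanical_neg_sub_one hα hα0 hα1 N)
  · exact (cfValue_proj_biDbl _).symm

theorem slope_eq_of_sturmianValue_eq {α α' : ℝ} {N N' : ℤ} (hα0 : 0 ≤ α) (hα1 : α < 1)
    (hα0' : 0 ≤ α') (hα1' : α' < 1) (h : sturmianValue α N = sturmianValue α' N') : α = α' :=
  slope_eq_of_rightOf_mechanical_eq hα0 hα1 hα0' hα1' (dblVal_injective h)

theorem not_countable_irrational_Ioo {a b : ℝ} (hab : a < b) :
    ¬ {x : ℝ | Irrational x ∧ x ∈ Set.Ioo a b}.Countable := by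
  intro h
  refine Cardinal.Real.Ioo_countable_iff.not.2 hab.not_ge ?_
  refine (h.union (Set.countable_range ((↑) : ℚ → ℝ))).mono fun x hx => ?_
  by_cases hirr : Irrational x
  · exact Or.inl ⟨hirr, hx⟩
  · exact Or.inr (not_not.1 hirr)

end

end LagrangeThree

theorem theorem2 (n : ℕ∞) : ¬ (LagrangeThree.Y3 n).Countable := by
  intro hY
  choose! N hN using fun α hα => LagrangeThree.exists_encard_records_eq (α := α) hα n
  have hmaps : Set.MapsTo (fun α => LagrangeThree.sturmianValue α (N α))
      {α | Irrational α ∧ α ∈ Set.Ioo 0 1} (LagrangeThree.Y3 n) := by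
    rintro α ⟨hα, h0, h1⟩
    exact hN α hα ▸ LagrangeThree.sturmianValue_mem_Y3 hα h0.le h1 (N α)
  have hinj : Set.InjOn (fun α => LagrangeThree.sturmianValue α (N α))
      {α | Irrational α ∧ α ∈ Set.Ioo 0 1} := by
    rintro α ⟨-, h0, h1⟩ α' ⟨-, h0', h1'⟩ h
    exact LagrangeThree.slope_eq_of_sturmianValue_eq h0.le h1 h0'.le h1' h
  exact LagrangeThree.not_countable_irrational_Ioo zero_lt_one (hmaps.countable_of_injOn hinj hY)
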